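/- Let $\Gamma$ be a discrete group with only finitely many finite subgroups up to conjugacy, and let $\mathcal F$ be a family of finite subgroups of $\Gamma$, that is, a non-empty collection of finite subgroups which is closed under conjugation by elements of $\Gamma$ and under taking subgroups. For a ring $A$ let $G(A)$ be the Grothendieck group of finitely generated left $A$-modules: the abelian group with generators $[M]$, one for each finitely generated left $A$-module $M$, and relations $[M]=[M']+[M'']$, one for each short exact sequence $0\to M'\to M\to M''\to 0$ of such modules. A homomorphism $\varphi\colon H\to K$ of finite groups induces $\varphi^*\colon G(\mathbb Q[K])\to G(\mathbb Q[H])$ by restriction of modules along $\varphi$; write $\mathrm{res}^K_H$ for this map when $\varphi$ is the inclusion of a subgroup, and $C_\gamma^*$ when $\varphi$ is $C_\gamma\colon H\to\gamma H\gamma^{-1}$, $h\mapsto\gamma h\gamma^{-1}$. Let $$G_{\mathcal F}(\mathbb Q[\Gamma])=\lim_{H\in\mathcal F}G(\mathbb Q[H])\subseteq\prod_{H\in\mathcal F}G(\mathbb Q[H])$$ be the subgroup of all $(x_H)_{H\in\mathcal F}$ such that $\mathrm{res}^K_H(x_K)=x_H$ whenever $H\subseteq K$ are in $\mathcal F$,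 and $C_\gamma^*(x_{\gamma H\gamma^{-1}})=x_H$ for all $H\in\mathcal F$ and $\gamma\in\Gamma$. Then $G_{\mathcal F}(\mathbb Q[\Gamma])$ is a free abelian group of finite rank, and its rank is $C_{\mathcal F}(\Gamma)$, the number of $\Gamma$-conjugacy classes of cyclic subgroups in $\mathcal F$. -/

import Mathlib

universe u v

noncomputable section

/-! ### The Grothendieck group of finitely generated modules over a ring -/

/-- The subgroup of relations: it is generated by the elements `[M] - [M'] - [M'']`, one for each
short exact sequence `0 → M' → M → M'' → 0` of finitely generated left `A`-modules. -/
def grothendieckRelations (A : Type u) [Ring A] :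
    AddSubgroup (FreeAbelianGroup (FGModuleCat.{u} A)) :=
  AddSubgroup.closure
    {x | ∃ (M' M M'' : FGModuleCat.{u} A) (f : M' →ₗ[A] M) (g : M →ₗ[A] M''),
      Function.Injective f ∧ Function.Exact f g ∧ Function.Surjective g ∧
      x = FreeAbelianGroup.of M - FreeAbelianGroup.of M' - FreeAbelianGroup.of M''}

/-- The Grothendieck group `G(A)` of finitely generated left `A`-modules. -/
abbrev GrothendieckG (A : Type u) [Ring A] : Type (u + 1) :=
  FreeAbelianGroup (FGModuleCat.{u} A) ⧸ grothendieckRelations A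

/-! ### Restriction along a homomorphism of groups, the target being finite -/

/-- A finitely generated module over the group ring `R[K]` of a finite group `K` is finitely
generated over `R[H]`, for every homomorphism `φ : H → K`. -/
theorem finite_restrictScalars_mapDomain (R : Type v) [CommRing R] {H K : Type u}
    [Group H] [Group K] [Finite K] (φ : H →* K)
    (M : FGModuleCat.{max u v} (MonoidAlgebra R K)) :
    Module.Finite (MonoidAlgebra R H)
      ((ModuleCat.restrictScalars (MonoidAlgebra.mapDomainRingHom R φ)).obj M.obj) := by
  have : Module.Finite R (MonoidAlgebra R K) :=
    Module.Finite.of_basis (MonoidAlgebra.basis K R)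
  let A := MonoidAlgebra R K
  let f := MonoidAlgebra.mapDomainRingHom R φ
  let N := (ModuleCat.restrictScalars f).obj M.obj
  let _ : Module R M := Module.compHom M (algebraMap R A)
  let _ : Module R N := inferInstanceAs (Module R M)
  have : IsScalarTower R A M := ⟨fun r a m => by
    rw [Algebra.smul_def, mul_smul]; rfl⟩
  have : Module.Finite R M := Module.Finite.trans A M
  have : Module.Finite R N := inferInstanceAs (Module.Finite R M)
  have : IsScalarTower R (MonoidAlgebra R H) N := ⟨fun r a m => by
    rw [Algebra.smul_def, mul_smul]
    change f (algebraMap R (MonoidAlgebra R H) r) • (a • m : N) =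
      algebraMap R A r • (a • m : N)
    rw [← MonoidAlgebra.mapDomainRingHom_comp_algebraMap (R := R) (A := R) φ]
    rfl⟩
  exact Module.Finite.of_restrictScalars_finite R (MonoidAlgebra R H) N

/-- The module over `R[H]` obtained from a finitely generated `R[K]`-module by restriction of
scalars along `R[H] → R[K]`. -/
def restrictModule (R : Type v) [CommRing R] {H K : Type u} [Group H] [Group K] [Finite K]
    (φ : H →* K) (M : FGModuleCat.{max u v} (MonoidAlgebra R K)) :
    FGModuleCat.{max u v} (MonoidAlgebra R H) :=
  ⟨(ModuleCat.restrictScalars (MonoidAlgebra.mapDomainRingHom R φ)).obj M.obj,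
    finite_restrictScalars_mapDomain R φ M⟩

theorem grothendieckRelations_le_comap (R : Type v) [CommRing R] {H K : Type u}
    [Group H] [Group K] [Finite K] (φ : H →* K) :
    grothendieckRelations (MonoidAlgebra R K) ≤
      (grothendieckRelations (MonoidAlgebra R H)).comap
        (FreeAbelianGroup.map (restrictModule R φ)) := by
  rw [grothendieckRelations, AddSubgroup.closure_le]
  rintro x ⟨M', M, M'', f, g, hf, hfg, hg, rfl⟩
  refine AddSubgroup.subset_closure
    ⟨restrictModule R φ M', restrictModule R φ M, restrictModule R φ M'',
      ((ModuleCat.restrictScalars (MonoidAlgebra.mapDomainRingHom R φ)).map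
        (ModuleCat.ofHom f)).hom,
      ((ModuleCat.restrictScalars (MonoidAlgebra.mapDomainRingHom R φ)).map
        (ModuleCat.ofHom g)).hom, hf, hfg, hg, ?_⟩
  simp

/-- The map `φ^* : G(R[K]) → G(R[H])`, `[M] ↦ [M restricted along φ]`. -/
def GrothendieckG.pullback (R : Type v) [CommRing R] {H K : Type u} [Group H] [Group K]
    [Finite K] (φ : H →* K) :
    GrothendieckG (MonoidAlgebra R K) →+ GrothendieckG (MonoidAlgebra R H) :=
  QuotientAddGroup.map _ _ (FreeAbelianGroup.map (restrictModule R φ))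
    (grothendieckRelations_le_comap R φ)

/-! ### Conjugacy of subgroups and families of finite subgroups -/

/-- The conjugate subgroup `γ H γ⁻¹`. -/
abbrev conjSubgroup {Γ : Type u} [Group Γ] (γ : Γ) (H : Subgroup Γ) : Subgroup Γ :=
  H.map (MulAut.conj γ).toMonoidHom

/-- The homomorphism `H → γ H γ⁻¹`, `h ↦ γ h γ⁻¹`. -/
abbrev conjHom {Γ : Type u} [Group Γ] (γ : Γ) (H : Subgroup Γ) : H →* conjSubgroup γ H :=
  (MulAut.conj γ).toMonoidHom.subgroupMap H

/-- The conjugacy class of a subgroup. -/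
def subgroupConjClass {Γ : Type u} [Group Γ] (H : Subgroup Γ) : Set (Subgroup Γ) :=
  {K | ∃ γ : Γ, K = conjSubgroup γ H}

/-- The finite conjugacy property: there are only finitely many finite subgroups up to
conjugacy. -/
def FiniteConjugacyProperty (Γ : Type u) [Group Γ] : Prop :=
  {c : Set (Subgroup Γ) | ∃ H : Subgroup Γ, Finite H ∧ c = subgroupConjClass H}.Finite

/-- A family of finite subgroups of `Γ`: a nonempty collection of finite subgroups that is closed
under conjugation and under passing to subgroups. -/
structure FiniteSubgroupFamily (Γ : Type u) [Group Γ] where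
  carrier : Set (Subgroup Γ)
  nonempty : carrier.Nonempty
  conj_mem : ∀ H ∈ carrier, ∀ γ : Γ, conjSubgroup γ H ∈ carrier
  mem_of_le : ∀ K ∈ carrier, ∀ H : Subgroup Γ, H ≤ K → H ∈ carrier
  finite_of_mem : ∀ H ∈ carrier, Finite H

namespace FiniteSubgroupFamily

variable {Γ : Type u} [Group Γ] (F : FiniteSubgroupFamily Γ)

instance (H : F.carrier) : Finite (H : Subgroup Γ) :=
  F.finite_of_mem H H.2

/-- The conjugate of a member of the family, as a member of the family. -/
def conj (γ : Γ) (H : F.carrier) : F.carrier :=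
  ⟨conjSubgroup γ (H : Subgroup Γ), F.conj_mem H H.2 γ⟩

/-- The homomorphism `C_γ : H → γ H γ⁻¹` between members of the family. -/
def conjMap (γ : Γ) (H : F.carrier) : (H : Subgroup Γ) →* (F.conj γ H : Subgroup Γ) :=
  conjHom γ (H : Subgroup Γ)

/-- `G_F(R[Γ]) = lim_{H ∈ F} G(R[H])`, the group of all families `(x_H)` in `∏_{H ∈ F} G(R[H])`
that are compatible with restriction to subgroups and with conjugation. -/
def limitG (R : Type v) [CommRing R] :
    AddSubgroup (∀ H : F.carrier, GrothendieckG (MonoidAlgebra R (H : Subgroup Γ))) where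
  carrier := {x |
    (∀ (H K : F.carrier) (hHK : (H : Subgroup Γ) ≤ (K : Subgroup Γ)),
      GrothendieckG.pullback R (Subgroup.inclusion hHK) (x K) = x H) ∧
    (∀ (H : F.carrier) (γ : Γ),
      GrothendieckG.pullback R (F.conjMap γ H) (x (F.conj γ H)) = x H)}
  zero_mem' := by simp
  add_mem' := by
    rintro x y ⟨hx, hx'⟩ ⟨hy, hy'⟩
    exact ⟨fun H K h => by simp [hx, hy], fun H γ => by simp [hx', hy']⟩
  neg_mem' := by
    rintro x ⟨hx, hx'⟩
    exact ⟨fun H K h => by simp [hx], fun H γ => by simp [hx']⟩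

/-- `C_F(Γ)`, the number of conjugacy classes of cyclic subgroups in the family. -/
def numCyclicClasses : ℕ :=
  {c : Set (Subgroup Γ) | ∃ H ∈ F.carrier, IsCyclic H ∧ c = subgroupConjClass H}.ncard

end FiniteSubgroupFamily

end

noncomputable section

/-! ### Traces of endomorphisms of finite order -/

open Module in
/-- The trace of a power of a diagonalizable endomorphism. -/
theorem LinearMap.exists_trace_pow_eq_sum_of_isSemisimple {K V : Type*} [Field K] [IsAlgClosed K]
    [AddCommGroup V] [Module K V] [FiniteDimensional K V] {f : End K V} (hf : f.IsSemisimple) :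
    ∃ s : Finset K, (∀ μ ∈ s, f.HasEigenvalue μ) ∧ ∀ k : ℕ,
      LinearMap.trace K V (f ^ k) = ∑ μ ∈ s, (finrank K (f.eigenspace μ) : K) * μ ^ k := by
  classical
  have hint : DirectSum.IsInternal f.eigenspace :=
    (DirectSum.isInternal_submodule_iff_iSupIndep_and_iSup_eq_top _).2
      ⟨f.eigenspaces_iSupIndep, hf.iSup_eigenspace_eq_top⟩
  have hfin : {μ | f.eigenspace μ ≠ ⊥}.Finite :=
    WellFoundedGT.finite_ne_bot_of_iSupIndep f.eigenspaces_iSupIndep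
  have hpow : ∀ (μ : K) (k : ℕ), ∀ x ∈ f.eigenspace μ, (f ^ k) x = μ ^ k • x := by
    intro μ k x hx
    rw [Module.End.mem_eigenspace_iff] at hx
    induction k with
    | zero => simp
    | succ k ih => rw [pow_succ', Module.End.mul_apply, ih, map_smul, hx, smul_smul, pow_succ]
  refine ⟨hfin.toFinset, fun μ hμ => by simpa [Module.End.hasEigenvalue_iff] using hμ,
    fun k => ?_⟩
  have hmaps : ∀ μ, Set.MapsTo (f ^ k) (f.eigenspace μ) (f.eigenspace μ) := fun μ x hx => by
    simp only [SetLike.mem_coe] at hx ⊢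
    rw [hpow μ k x hx]
    exact Submodule.smul_mem _ _ hx
  rw [LinearMap.trace_eq_sum_trace_restrict' hint hfin hmaps]
  refine Finset.sum_congr rfl fun μ _ => ?_
  have : (f ^ k).restrict (hmaps μ) = μ ^ k • LinearMap.id := by
    ext x
    exact hpow μ k x x.2
  rw [this, map_smul, LinearMap.trace_id, smul_eq_mul, mul_comm]

open Module in
theorem Module.End.HasEigenvalue.pow_eq_one {K V : Type*} [Field K] [AddCommGroup V] [Module K V]
    {f : End K V} {n : ℕ} (hf : f ^ n = 1) {μ : K} (hμ : f.HasEigenvalue μ) : μ ^ n = 1 := by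
  obtain ⟨x, hx⟩ := (hμ.pow n).exists_hasEigenvector
  have h := hx.apply_eq_smul
  rw [hf, Module.End.one_apply] at h
  have h' : (μ ^ n - 1) • x = 0 := by rw [sub_smul, ← h, one_smul, sub_self]
  exact sub_eq_zero.1 ((smul_eq_zero.1 h').resolve_right hx.2)

-- In characteristic zero `X ^ n - 1` is separable, hence squarefree, and it annihilates `f`.
open Module Polynomial in
theorem Module.End.isSemisimple_of_pow_eq_one {K V : Type*} [Field K] [CharZero K]
    [AddCommGroup V] [Module K V] [FiniteDimensional K V] {f : End K V} {n : ℕ} (hn : n ≠ 0)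
    (hf : f ^ n = 1) : f.IsSemisimple :=
  Module.End.isSemisimple_of_squarefree_aeval_eq_zero (p := X ^ n - 1)
    (Polynomial.X_pow_sub_one_separable_iff.2 (by exact_mod_cast hn)).squarefree (by simp [hf])

/-- An automorphism of the algebraic closure of `ℚ` which raises `n`-th roots of unity to the
`k`-th power, for `k` prime to `n`. -/
theorem exists_algEquiv_rootsOfUnity_pow {n k : ℕ} (hn : n ≠ 0) (hk : k.Coprime n) :
    ∃ σ : AlgebraicClosure ℚ ≃ₐ[ℚ] AlgebraicClosure ℚ, ∀ μ, μ ^ n = 1 → σ μ = μ ^ k := by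
  have : NeZero n := ⟨hn⟩
  obtain ⟨ζ, hζ⟩ := HasEnoughRootsOfUnity.exists_primitiveRoot (AlgebraicClosure ℚ) n
  -- Both are primitive `n`-th roots of unity, with minimal polynomial the cyclotomic polynomial, so
  -- they are Galois conjugate.
  have h : minpoly ℚ ζ = minpoly ℚ (ζ ^ k) := by
    rw [← Polynomial.cyclotomic_eq_minpoly_rat hζ hn.bot_lt,
      ← Polynomial.cyclotomic_eq_minpoly_rat (hζ.pow_of_coprime k hk) hn.bot_lt]
  have : Algebra.IsAlgebraic ℚ (AlgebraicClosure ℚ) := by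
    rw [Subsingleton.elim DivisionRing.toRatAlgebra (AlgebraicClosure.instAlgebra ℚ)]
    exact AlgebraicClosure.isAlgebraic ℚ
  have : IsAlgClosure ℚ (AlgebraicClosure ℚ) := ⟨inferInstance, inferInstance⟩
  have : Normal ℚ (AlgebraicClosure ℚ) := IsAlgClosure.normal ℚ (AlgebraicClosure ℚ)
  obtain ⟨σ, hσ⟩ := (Normal.minpoly_eq_iff_mem_orbit (F := ℚ) (E := AlgebraicClosure ℚ)).1 h.symm
  refine ⟨σ, fun μ hμ => ?_⟩
  obtain ⟨i, -, rfl⟩ := hζ.eq_pow_of_pow_eq_one hμ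
  have hσ' : σ ζ = ζ ^ k := hσ
  rw [map_pow, hσ', ← pow_mul, ← pow_mul, mul_comm]

section FiniteOrder

open Module

variable {V : Type*} [AddCommGroup V] [Module ℚ V] [FiniteDimensional ℚ V] {f : End ℚ V} {n : ℕ}

/-- Diagonalize after base change to the algebraic closure; `m` gives eigenspace dimensions. That
`s` and `m` serve all `k` at once is what permits comparing `f ^ k` with `f`. -/
theorem LinearMap.exists_algebraMap_trace_pow_eq_sum (hn : n ≠ 0) (hf : f ^ n = 1) :
    ∃ (s : Finset (AlgebraicClosure ℚ)) (m : AlgebraicClosure ℚ → ℕ),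
      (∀ μ ∈ s, μ ^ n = 1) ∧ ∀ k : ℕ,
        algebraMap ℚ (AlgebraicClosure ℚ) (LinearMap.trace ℚ V (f ^ k)) =
          ∑ μ ∈ s, (m μ : AlgebraicClosure ℚ) * μ ^ k := by
  let K := AlgebraicClosure ℚ
  let f' : End K (TensorProduct ℚ K V) := LinearMap.baseChange K f
  have hpow : ∀ k, LinearMap.baseChange K (f ^ k) = f' ^ k := fun k =>
    LinearMap.baseChange_pow _ _ _ f k
  have hf' : f' ^ n = 1 := by rw [← hpow, hf]; exact LinearMap.baseChange_id
  obtain ⟨s, hs, h⟩ := LinearMap.exists_trace_pow_eq_sum_of_isSemisimple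
    (Module.End.isSemisimple_of_pow_eq_one hn hf')
  refine ⟨s, fun μ => finrank K (f'.eigenspace μ), fun μ hμ => (hs μ hμ).pow_eq_one hf',
    fun k => ?_⟩
  rw [← LinearMap.trace_baseChange, hpow]
  exact h k

/-- The trace of a rational endomorphism of finite order is an integer. -/
theorem LinearMap.exists_int_trace_eq_of_pow_eq_one (hn : n ≠ 0) (hf : f ^ n = 1) :
    ∃ z : ℤ, LinearMap.trace ℚ V f = z := by
  obtain ⟨s, m, hs, h⟩ := LinearMap.exists_algebraMap_trace_pow_eq_sum hn hf
  -- A sum of roots of unity is an algebraic integer, and a rational algebraic integer lies in `ℤ`.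
  have hint : IsIntegral ℤ (algebraMap ℚ (AlgebraicClosure ℚ) (LinearMap.trace ℚ V f)) := by
    rw [← pow_one f, h 1]
    refine IsIntegral.sum _ fun μ hμ => IsIntegral.mul ?_ (IsIntegral.pow ?_ 1)
    · simpa using isIntegral_algebraMap (R := ℤ) (A := AlgebraicClosure ℚ) (x := (m μ : ℤ))
    · exact IsIntegral.of_pow hn.bot_lt (by rw [hs μ hμ]; exact isIntegral_one)
  rw [isIntegral_algebraMap_iff (algebraMap ℚ (AlgebraicClosure ℚ)).injective] at hint
  obtain ⟨z, hz⟩ := IsIntegrallyClosed.isIntegral_iff.1 hint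
  exact ⟨z, by simpa using hz.symm⟩

/-- A rational endomorphism of finite order has the same trace as its powers with exponent prime
to the order. -/
theorem LinearMap.trace_pow_eq_of_coprime (hn : n ≠ 0) (hf : f ^ n = 1) {k : ℕ}
    (hk : k.Coprime n) : LinearMap.trace ℚ V (f ^ k) = LinearMap.trace ℚ V f := by
  obtain ⟨s, m, hs, h⟩ := LinearMap.exists_algebraMap_trace_pow_eq_sum hn hf
  obtain ⟨σ, hσ⟩ := exists_algEquiv_rootsOfUnity_pow hn hk
  apply (algebraMap ℚ (AlgebraicClosure ℚ)).injective
  -- The automorphism `σ` fixes the rational trace of `f`, while turning each `μ` in its expansion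
  -- into `μ ^ k`.
  rw [h k, ← σ.commutes (LinearMap.trace ℚ V f)]
  conv_rhs => rw [← pow_one f, h 1, map_sum]
  refine Finset.sum_congr rfl fun μ hμ => ?_
  rw [map_mul, map_natCast, pow_one, hσ μ (hs μ hμ)]

end FiniteOrder

open scoped MonoidAlgebra
open Module

/-! ### Characters of modules over group algebras -/

namespace MonoidAlgebra

section ModuleCharacter

variable (k : Type*) [Field k] (G : Type*) [Group G]

/-- The character of a module over a group algebra. -/
def moduleCharacter (M : Type*) [AddCommGroup M] [Module k M] [Module k[G] M]
    [IsScalarTower k k[G] M] : G → k :=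
  (Representation.ofModule' (k := k) (G := G) M).character

variable {k G}
variable {M N P : Type*} [AddCommGroup M] [Module k M] [Module k[G] M] [IsScalarTower k k[G] M]
  [AddCommGroup N] [Module k N] [Module k[G] N] [IsScalarTower k k[G] N]
  [AddCommGroup P] [Module k P] [Module k[G] P] [IsScalarTower k k[G] P]

theorem ofModule'_apply (g : G) (m : M) :
    Representation.ofModule' (k := k) (G := G) M g m = (single g 1 : k[G]) • m := by
  simp [Representation.ofModule']

theorem moduleCharacter_apply (g : G) : moduleCharacter k G M g =
    LinearMap.trace k M (Representation.ofModule' (k := k) (G := G) M g) := rfl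

theorem moduleCharacter_congr (e : M ≃ₗ[k[G]] N) :
    moduleCharacter k G M = moduleCharacter k G N := by
  ext g
  rw [moduleCharacter_apply, moduleCharacter_apply,
    ← LinearMap.trace_conj' _ (e.restrictScalars k)]
  congr 1
  ext n
  simp [LinearEquiv.conj_apply, ofModule'_apply]

theorem moduleCharacter_prod [FiniteDimensional k M] [FiniteDimensional k N] :
    moduleCharacter k G (M × N) = moduleCharacter k G M + moduleCharacter k G N := by
  ext g
  rw [Pi.add_apply, moduleCharacter_apply, moduleCharacter_apply, moduleCharacter_apply,
    ← LinearMap.trace_prodMap']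
  rfl

/-- By Maschke's theorem `f` has an equivariant retraction, which splits the sequence. -/
theorem moduleCharacter_exact [Finite G] [NeZero (Nat.card G : k)] [FiniteDimensional k M]
    [FiniteDimensional k P] {f : M →ₗ[k[G]] N} {g : N →ₗ[k[G]] P}
    (hf : Function.Injective f) (hfg : Function.Exact f g) (hg : Function.Surjective g) :
    moduleCharacter k G N = moduleCharacter k G M + moduleCharacter k G P := by
  obtain ⟨r, hr⟩ := exists_leftInverse_of_injective f (LinearMap.ker_eq_bot.2 hf)
  have hr' : ∀ x, r (f x) = x := fun x => LinearMap.congr_fun hr x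
  have hbij : Function.Bijective (r.prod g) := by
    constructor
    · rw [injective_iff_map_eq_zero]
      intro x hx
      obtain ⟨hx₁, hx₂⟩ := Prod.ext_iff.1 hx
      obtain ⟨y, rfl⟩ := (hfg x).1 hx₂
      have hy : y = 0 := by simpa [hr'] using hx₁
      rw [hy, map_zero]
    · rintro ⟨a, b⟩
      obtain ⟨x, rfl⟩ := hg b
      exact ⟨x + f (a - r x), by simp [hr', hfg.apply_apply_eq_zero]⟩
  rw [moduleCharacter_congr (LinearEquiv.ofBijective _ hbij), moduleCharacter_prod]

/-- Two modules over a group algebra with the same character have a nonzero homomorphism between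
them. -/
theorem exists_linearMap_ne_zero [Finite G] [CharZero k] [FiniteDimensional k M]
    [FiniteDimensional k N] [Nontrivial M] (h : moduleCharacter k G M = moduleCharacter k G N) :
    ∃ f : M →ₗ[k[G]] N, f ≠ 0 := by
  have := Fintype.ofFinite G
  have : NeZero (Nat.card G : k) := ⟨Nat.cast_ne_zero.2 Nat.card_pos.ne'⟩
  have : Invertible (Nat.card G : k) := invertibleOfNonzero (NeZero.ne _)
  let ρ := Representation.ofModule' (k := k) (G := G) M
  let σ := Representation.ofModule' (k := k) (G := G) N
  -- The same character sum computes the dimensions of `Hom(M, N)` and `End(M)`, and the latter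
  -- contains the nonzero identity.
  have h₁ := Representation.card_inv_mul_sum_char_mul_char_eq_finrank ρ σ
  have h₂ := Representation.card_inv_mul_sum_char_mul_char_eq_finrank ρ ρ
  have h' : ρ.character = σ.character := h
  rw [← h', h₂, Nat.cast_inj] at h₁
  have hpos : 0 < finrank k (Representation.IntertwiningMap ρ ρ) := by
    have : Nontrivial (Representation.IntertwiningMap ρ ρ) := by
      obtain ⟨x, hx⟩ := exists_ne (0 : M)
      exact ⟨⟨.id ρ, 0, fun h0 => hx (DFunLike.congr_fun h0 x)⟩⟩
    have : FiniteDimensional k (Representation.IntertwiningMap ρ ρ) :=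
      Module.Finite.equiv (Representation.invariantsEquivIntertwiningMap ρ ρ)
    exact finrank_pos
  rw [h₁] at hpos
  have := nontrivial_of_finrank_pos hpos
  obtain ⟨φ, hφ⟩ := exists_ne (0 : Representation.IntertwiningMap ρ σ)
  refine ⟨equivariantOfLinearOfComm φ.toLinearMap fun g v => ?_, fun h0 => hφ ?_⟩
  · rw [← ofModule'_apply, ← ofModule'_apply]
    exact LinearMap.congr_fun (φ.isIntertwining' g) v
  · ext x
    exact LinearMap.congr_fun h0 x

end ModuleCharacter

end MonoidAlgebra

open MonoidAlgebra

/-! ### The character of an element of the Grothendieck group -/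

namespace GrothendieckG

section Class

variable {A : Type u} [Ring A]

/-- The class of a finitely generated module. -/
def mk (M : Type u) [AddCommGroup M] [Module A M] [Module.Finite A M] : GrothendieckG A :=
  QuotientAddGroup.mk (FreeAbelianGroup.of (FGModuleCat.of A M))

variable {M N P : Type u} [AddCommGroup M] [Module A M] [Module.Finite A M]
  [AddCommGroup N] [Module A N] [Module.Finite A N]
  [AddCommGroup P] [Module A P] [Module.Finite A P]

theorem mk_exact {f : M →ₗ[A] N} {g : N →ₗ[A] P} (hf : Function.Injective f)
    (hfg : Function.Exact f g) (hg : Function.Surjective g) :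
    (mk N : GrothendieckG A) = mk M + mk P := by
  rw [← sub_eq_zero, ← sub_sub]
  refine (QuotientAddGroup.eq_zero_iff (N := grothendieckRelations A) _).2 ?_
  exact AddSubgroup.subset_closure
    ⟨FGModuleCat.of A M, FGModuleCat.of A N, FGModuleCat.of A P, f, g, hf, hfg, hg, rfl⟩

theorem mk_eq_zero_of_subsingleton [Subsingleton M] : (mk M : GrothendieckG A) = 0 := by
  -- For `M = 0` the sequence `M → M → M` of identities is short exact, so `[M] = [M] + [M]`.
  have h := mk_exact (A := A) (f := LinearMap.id (M := M)) (g := LinearMap.id (M := M))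
    (fun _ _ h => h) (fun x => ⟨fun _ => ⟨x, rfl⟩, fun _ => Subsingleton.elim _ _⟩)
    (fun x => ⟨x, rfl⟩)
  exact left_eq_add.1 h

theorem mk_prod : (mk (M × N) : GrothendieckG A) = mk M + mk N :=
  mk_exact (f := LinearMap.inl A M N) (g := LinearMap.snd A M N) LinearMap.inl_injective
    Function.Exact.inl_snd LinearMap.snd_surjective

theorem exists_eq_mk_sub_mk (x : GrothendieckG A) :
    ∃ V W : FGModuleCat.{u} A, x = mk V - mk W := by
  induction x using QuotientAddGroup.induction_on with
  | H y =>
    induction y using FreeAbelianGroup.induction_on with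
    | zero => exact ⟨FGModuleCat.of A PUnit, FGModuleCat.of A PUnit, (sub_self _).symm⟩
    | of V =>
      exact ⟨V, FGModuleCat.of A PUnit, by
        rw [mk_eq_zero_of_subsingleton (M := PUnit), sub_zero]; rfl⟩
    | neg V =>
      exact ⟨FGModuleCat.of A PUnit, V, by
        rw [mk_eq_zero_of_subsingleton (M := PUnit), zero_sub]; rfl⟩
    | add y z hy hz =>
      obtain ⟨V, W, h⟩ := hy
      obtain ⟨V', W', h'⟩ := hz
      refine ⟨FGModuleCat.of A (V × V'), FGModuleCat.of A (W × W'), ?_⟩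
      rw [QuotientAddGroup.mk_add, h, h']
      change _ = mk (V × V') - mk (W × W')
      rw [mk_prod, mk_prod]
      abel

theorem hom_ext {B : Type*} [AddCommGroup B] {φ ψ : GrothendieckG A →+ B}
    (h : ∀ V : FGModuleCat.{u} A, φ (mk V) = ψ (mk V)) : φ = ψ :=
  QuotientAddGroup.addMonoidHom_ext _ (FreeAbelianGroup.lift_ext _ _ h)

end Class

section Character

variable {G : Type u} [Group G]

theorem finiteDimensional_of_finite [Finite G] (M : Type*) [AddCommGroup M] [Module ℚ M]
    [Module ℚ[G] M] [IsScalarTower ℚ ℚ[G] M] [Module.Finite ℚ[G] M] : FiniteDimensional ℚ M :=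
  have : Module.Finite ℚ ℚ[G] := Module.Finite.of_basis (MonoidAlgebra.basis G ℚ)
  Module.Finite.trans ℚ[G] M

/-- The character of a finitely generated `ℚ[G]`-module. -/
def fgCharacter (M : FGModuleCat.{u} ℚ[G]) : G → ℚ :=
  letI : Module ℚ M := Module.compHom M (algebraMap ℚ ℚ[G])
  haveI : IsScalarTower ℚ ℚ[G] M := IsScalarTower.of_compHom ℚ ℚ[G] M
  moduleCharacter ℚ G M

theorem fgCharacter_of (M : Type u) [AddCommGroup M] [i : Module ℚ M] [Module ℚ[G] M]
    [IsScalarTower ℚ ℚ[G] M] [Module.Finite ℚ[G] M] :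
    fgCharacter (FGModuleCat.of ℚ[G] M) = moduleCharacter ℚ G M := by
  have : i = Module.compHom M (algebraMap ℚ ℚ[G]) := Subsingleton.elim _ _
  subst this
  rfl

/-- Additive maps of `ℚ`-vector spaces are `ℚ`-linear, so the `ℚ`-structures obtained through two
different group rings need no comparison. -/
theorem moduleCharacter_apply_eq_of_addEquiv {H : Type*} [Group H] {V W : Type*} [AddCommGroup V]
    [Module ℚ V] [Module ℚ[G] V] [IsScalarTower ℚ ℚ[G] V] [AddCommGroup W] [Module ℚ W]
    [Module ℚ[H] W] [IsScalarTower ℚ ℚ[H] W] (e : W ≃+ V) {h : H} {g : G}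
    (he : ∀ w, e ((single h 1 : ℚ[H]) • w) = (single g 1 : ℚ[G]) • e w) :
    moduleCharacter ℚ H W h = moduleCharacter ℚ G V g := by
  let e' : W ≃ₗ[ℚ] V := e.toLinearEquiv fun c x => map_rat_smul e c x
  rw [moduleCharacter_apply, moduleCharacter_apply, ← LinearMap.trace_conj' _ e']
  congr 1
  ext v
  rw [LinearEquiv.conj_apply_apply, ofModule'_apply, ofModule'_apply]
  exact (he (e.symm v)).trans (by rw [e.apply_symm_apply])

variable [Finite G]

theorem fgCharacter_exact {M N P : FGModuleCat.{u} ℚ[G]} {f : M →ₗ[ℚ[G]] N} {g : N →ₗ[ℚ[G]] P}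
    (hf : Function.Injective f) (hfg : Function.Exact f g) (hg : Function.Surjective g) :
    fgCharacter N = fgCharacter M + fgCharacter P := by
  let : Module ℚ M := Module.compHom M (algebraMap ℚ ℚ[G])
  have : IsScalarTower ℚ ℚ[G] M := IsScalarTower.of_compHom ℚ ℚ[G] M
  let : Module ℚ N := Module.compHom N (algebraMap ℚ ℚ[G])
  have : IsScalarTower ℚ ℚ[G] N := IsScalarTower.of_compHom ℚ ℚ[G] N
  let : Module ℚ P := Module.compHom P (algebraMap ℚ ℚ[G])
  have : IsScalarTower ℚ ℚ[G] P := IsScalarTower.of_compHom ℚ ℚ[G] P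
  have := finiteDimensional_of_finite (G := G) M
  have := finiteDimensional_of_finite (G := G) P
  have : NeZero (Nat.card G : ℚ) := ⟨Nat.cast_ne_zero.2 Nat.card_pos.ne'⟩
  exact moduleCharacter_exact hf hfg hg

variable (G) in
/-- The character of an element of the Grothendieck group. -/
def character : GrothendieckG ℚ[G] →+ (G → ℚ) :=
  QuotientAddGroup.lift _ (FreeAbelianGroup.lift fgCharacter) <| by
    rw [grothendieckRelations, AddSubgroup.closure_le]
    rintro x ⟨M', M, M'', f, g, hf, hfg, hg, rfl⟩
    simp [fgCharacter_exact hf hfg hg, AddMonoidHom.mem_ker]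

theorem character_mk_fg (M : FGModuleCat.{u} ℚ[G]) : character G (mk M) = fgCharacter M :=
  FreeAbelianGroup.lift_apply_of _ _

theorem character_mk (M : Type u) [AddCommGroup M] [Module ℚ M] [Module ℚ[G] M]
    [IsScalarTower ℚ ℚ[G] M] [Module.Finite ℚ[G] M] :
    character G (mk M) = moduleCharacter ℚ G M :=
  (character_mk_fg (FGModuleCat.of ℚ[G] M)).trans (fgCharacter_of M)

/-- Equal characters give a nonzero map `f : V → W` when `V ≠ 0`. Cancelling the common image leaves
`ker f` and `coker f`, again with equal characters and of smaller dimension. -/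
theorem mk_eq_mk_of_moduleCharacter_eq (n : ℕ) : ∀ (V W : Type u) [AddCommGroup V] [Module ℚ V]
    [Module ℚ[G] V] [IsScalarTower ℚ ℚ[G] V] [Module.Finite ℚ[G] V] [AddCommGroup W] [Module ℚ W]
    [Module ℚ[G] W] [IsScalarTower ℚ ℚ[G] W] [Module.Finite ℚ[G] W], finrank ℚ V = n →
    moduleCharacter ℚ G V = moduleCharacter ℚ G W → (mk V : GrothendieckG ℚ[G]) = mk W := by
  induction n using Nat.strong_induction_on with
  | h n ih =>
    intro V W _ _ _ _ _ _ _ _ _ _ hn h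
    have hV := finiteDimensional_of_finite (G := G) V
    have hW := finiteDimensional_of_finite (G := G) W
    have hdim : finrank ℚ V = finrank ℚ W := by
      have h1 := congr_fun h 1
      simpa [moduleCharacter] using h1
    rcases subsingleton_or_nontrivial V with hs | hs
    · have : Subsingleton W := by
        rw [← finrank_zero_iff (R := ℚ), ← hdim, finrank_zero_iff]
        exact hs
      rw [mk_eq_zero_of_subsingleton, mk_eq_zero_of_subsingleton]
    · obtain ⟨f, hf⟩ := exists_linearMap_ne_zero h
      have : Module.Finite ℚ ℚ[G] := Module.Finite.of_basis (MonoidAlgebra.basis G ℚ)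
      have : IsNoetherianRing ℚ[G] := isNoetherian_of_tower ℚ inferInstance
      have : NeZero (Nat.card G : ℚ) := ⟨Nat.cast_ne_zero.2 Nat.card_pos.ne'⟩
      have := finiteDimensional_of_finite (G := G) (LinearMap.ker f)
      have := finiteDimensional_of_finite (G := G) (LinearMap.range f)
      have := finiteDimensional_of_finite (G := G) (W ⧸ LinearMap.range f)
      have hinj₁ : Function.Injective (LinearMap.ker f).subtype := Subtype.val_injective
      have hex₁ : Function.Exact (LinearMap.ker f).subtype f.rangeRestrict := fun x => by
        rw [Submodule.coe_subtype, Subtype.range_coe, SetLike.mem_coe, LinearMap.mem_ker]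
        exact Subtype.ext_iff
      have hsurj₁ : Function.Surjective f.rangeRestrict := f.surjective_rangeRestrict
      have hinj₂ : Function.Injective (LinearMap.range f).subtype := Subtype.val_injective
      have hex₂ : Function.Exact (LinearMap.range f).subtype (LinearMap.range f).mkQ :=
        LinearMap.exact_subtype_mkQ _
      have hsurj₂ : Function.Surjective (LinearMap.range f).mkQ := Submodule.mkQ_surjective _
      rw [mk_exact hinj₁ hex₁ hsurj₁, mk_exact hinj₂ hex₂ hsurj₂, add_comm]
      rw [moduleCharacter_exact hinj₁ hex₁ hsurj₁, moduleCharacter_exact hinj₂ hex₂ hsurj₂,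
        add_comm, add_right_inj] at h
      congr 1
      refine ih _ ?_ _ _ rfl h
      rw [← hn]
      have hlt : (LinearMap.ker f).restrictScalars ℚ < ⊤ := by
        rw [lt_top_iff_ne_top]
        intro htop
        apply hf
        rw [← LinearMap.ker_eq_top]
        exact (Submodule.restrictScalars_eq_top_iff ℚ ℚ[G] V).1 htop
      exact Submodule.finrank_lt hlt.ne

theorem character_injective : Function.Injective (character G) := by
  rw [injective_iff_map_eq_zero]
  intro x hx
  obtain ⟨V, W, rfl⟩ := exists_eq_mk_sub_mk x
  rw [map_sub, sub_eq_zero] at hx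
  let : Module ℚ V := Module.compHom V (algebraMap ℚ ℚ[G])
  have : IsScalarTower ℚ ℚ[G] V := IsScalarTower.of_compHom ℚ ℚ[G] V
  let : Module ℚ W := Module.compHom W (algebraMap ℚ ℚ[G])
  have : IsScalarTower ℚ ℚ[G] W := IsScalarTower.of_compHom ℚ ℚ[G] W
  rw [character_mk, character_mk] at hx
  rw [sub_eq_zero]
  exact mk_eq_mk_of_moduleCharacter_eq _ V W rfl hx

theorem character_pullback {H : Type u} [Group H] [Finite H] (φ : H →* G)
    (x : GrothendieckG ℚ[G]) (h : H) :
    character H (pullback ℚ φ x) h = character G x (φ h) := by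
  have key : ((Pi.evalAddMonoidHom _ h).comp (character H)).comp (pullback ℚ φ) =
      (Pi.evalAddMonoidHom _ (φ h)).comp (character G) := by
    refine hom_ext fun V => ?_
    change character H (mk (restrictModule ℚ φ V)) h = character G (mk V) (φ h)
    let : Module ℚ V := Module.compHom V (algebraMap ℚ ℚ[G])
    have : IsScalarTower ℚ ℚ[G] V := IsScalarTower.of_compHom ℚ ℚ[G] V
    let W := restrictModule ℚ φ V
    let : Module ℚ W := Module.compHom W (algebraMap ℚ ℚ[H])
    have : IsScalarTower ℚ ℚ[H] W := IsScalarTower.of_compHom ℚ ℚ[H] W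
    rw [character_mk, character_mk]
    have hφ : mapDomainRingHom ℚ φ (single h 1) = single (φ h) 1 := by simp
    exact moduleCharacter_apply_eq_of_addEquiv (G := G) (H := H) (V := V) (W := W)
      (AddEquiv.refl V) fun (w : V) => congrArg (fun a : ℚ[G] => a • w) hφ
  exact DFunLike.congr_fun key x

theorem exists_int_character_eq (x : GrothendieckG ℚ[G]) (g : G) :
    ∃ z : ℤ, character G x g = z := by
  obtain ⟨V, W, rfl⟩ := exists_eq_mk_sub_mk x
  have key : ∀ V : FGModuleCat.{u} ℚ[G], ∃ z : ℤ, character G (mk V) g = z := fun V => by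
    let : Module ℚ V := Module.compHom V (algebraMap ℚ ℚ[G])
    have : IsScalarTower ℚ ℚ[G] V := IsScalarTower.of_compHom ℚ ℚ[G] V
    have := finiteDimensional_of_finite (G := G) V
    rw [character_mk, moduleCharacter_apply]
    exact LinearMap.exists_int_trace_eq_of_pow_eq_one (orderOf_pos g).ne'
      (by rw [← map_pow, pow_orderOf_eq_one, map_one])
  obtain ⟨a, ha⟩ := key V
  obtain ⟨b, hb⟩ := key W
  exact ⟨a - b, by rw [map_sub, Pi.sub_apply, ha, hb, Int.cast_sub]⟩

theorem character_pow_of_coprime (x : GrothendieckG ℚ[G]) (g : G) {k : ℕ}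
    (hk : k.Coprime (orderOf g)) : character G x (g ^ k) = character G x g := by
  obtain ⟨V, W, rfl⟩ := exists_eq_mk_sub_mk x
  have key : ∀ V : FGModuleCat.{u} ℚ[G], character G (mk V) (g ^ k) = character G (mk V) g :=
    fun V => by
    let : Module ℚ V := Module.compHom V (algebraMap ℚ ℚ[G])
    have : IsScalarTower ℚ ℚ[G] V := IsScalarTower.of_compHom ℚ ℚ[G] V
    have := finiteDimensional_of_finite (G := G) V
    rw [character_mk, moduleCharacter_apply, moduleCharacter_apply, map_pow]
    exact LinearMap.trace_pow_eq_of_coprime (orderOf_pos g).ne'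
      (by rw [← map_pow, pow_orderOf_eq_one, map_one]) hk
  rw [map_sub, Pi.sub_apply, Pi.sub_apply, key, key]

/-- Two generators of a finite cyclic group are powers of each other with exponent prime to the
order. -/
theorem character_eq_of_zpowers_eq (x : GrothendieckG ℚ[G]) {g h : G}
    (hgh : Subgroup.zpowers g = Subgroup.zpowers h) : character G x g = character G x h := by
  have hg : g ∈ Subgroup.zpowers h := hgh ▸ Subgroup.mem_zpowers g
  obtain ⟨k, rfl⟩ := mem_powers_iff_mem_zpowers.2 hg
  refine character_pow_of_coprime x h ?_
  have hcard : orderOf (h ^ k) = orderOf h := by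
    rw [← Nat.card_zpowers, ← Nat.card_zpowers, hgh]
  rw [orderOf_pow, Nat.div_eq_self] at hcard
  rcases hcard with h0 | h1
  · exact absurd h0 (orderOf_pos h).ne'
  · rwa [Nat.coprime_comm]

theorem character_conj (x : GrothendieckG ℚ[G]) (g h : G) :
    character G x (h * g * h⁻¹) = character G x g := by
  obtain ⟨V, W, rfl⟩ := exists_eq_mk_sub_mk x
  have key : ∀ V : FGModuleCat.{u} ℚ[G],
      character G (mk V) (h * g * h⁻¹) = character G (mk V) g := fun V => by
    let : Module ℚ V := Module.compHom V (algebraMap ℚ ℚ[G])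
    have : IsScalarTower ℚ ℚ[G] V := IsScalarTower.of_compHom ℚ ℚ[G] V
    rw [character_mk]
    exact Representation.char_conj _ g h
  rw [map_sub, Pi.sub_apply, Pi.sub_apply, key, key]

end Character

end GrothendieckG

/-! ### Conjugacy classes of subgroups and of cyclic subgroups -/

section ConjClass

variable {Γ : Type u} [Group Γ]

theorem conjSubgroup_conjSubgroup (a b : Γ) (H : Subgroup Γ) :
    conjSubgroup a (conjSubgroup b H) = conjSubgroup (a * b) H := by
  rw [conjSubgroup, conjSubgroup, Subgroup.map_map]
  congr 1
  ext x
  simp [mul_assoc]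

theorem conjSubgroup_one (H : Subgroup Γ) : conjSubgroup 1 H = H := by
  rw [conjSubgroup, map_one]
  exact Subgroup.map_id H

theorem conjSubgroup_zpowers (a g : Γ) :
    conjSubgroup a (Subgroup.zpowers g) = Subgroup.zpowers (a * g * a⁻¹) :=
  MonoidHom.map_zpowers _ g

theorem mem_subgroupConjClass_self (H : Subgroup Γ) : H ∈ subgroupConjClass H :=
  ⟨1, (conjSubgroup_one H).symm⟩

theorem subgroupConjClass_eq_iff {H K : Subgroup Γ} :
    subgroupConjClass H = subgroupConjClass K ↔ ∃ γ : Γ, K = conjSubgroup γ H := by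
  constructor
  · intro h
    have := mem_subgroupConjClass_self K
    rwa [← h] at this
  · rintro ⟨γ, rfl⟩
    ext L
    constructor
    · rintro ⟨δ, rfl⟩
      exact ⟨δ * γ⁻¹, by rw [conjSubgroup_conjSubgroup, inv_mul_cancel_right]⟩
    · rintro ⟨δ, rfl⟩
      exact ⟨δ * γ, by rw [conjSubgroup_conjSubgroup]⟩

theorem subgroupConjClass_zpowers_eq_iff {g h : Γ} :
    subgroupConjClass (Subgroup.zpowers g) = subgroupConjClass (Subgroup.zpowers h) ↔
      ∃ γ : Γ, Subgroup.zpowers h = Subgroup.zpowers (γ * g * γ⁻¹) := by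
  rw [subgroupConjClass_eq_iff]
  simp_rw [conjSubgroup_zpowers]

theorem subgroupConjClass_zpowers_coe_eq {H : Subgroup Γ} {g h : H}
    (hgh : subgroupConjClass (Subgroup.zpowers g) = subgroupConjClass (Subgroup.zpowers h)) :
    subgroupConjClass (Subgroup.zpowers (g : Γ)) = subgroupConjClass (Subgroup.zpowers (h : Γ)) := by
  rw [subgroupConjClass_zpowers_eq_iff] at hgh ⊢
  obtain ⟨γ, hγ⟩ := hgh
  refine ⟨γ, ?_⟩
  have := congrArg (Subgroup.map H.subtype) hγ
  rwa [MonoidHom.map_zpowers, MonoidHom.map_zpowers] at this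

end ConjClass

/-! ### Multiples of class functions are virtual characters -/

namespace GrothendieckG

variable {G : Type u} [Group G] [Finite G]

theorem character_eq_of_subgroupConjClass_eq (x : GrothendieckG ℚ[G]) {g h : G}
    (hgh : subgroupConjClass (Subgroup.zpowers g) = subgroupConjClass (Subgroup.zpowers h)) :
    character G x g = character G x h := by
  obtain ⟨γ, hγ⟩ := subgroupConjClass_zpowers_eq_iff.1 hgh
  rw [character_eq_of_zpowers_eq x hγ, character_conj]

/-- The class of the permutation module `ℚ[G/D]`. -/
def permClass (D : Subgroup G) : GrothendieckG ℚ[G] :=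
  have : Module.Finite ℚ ℚ[G ⧸ D] := Module.Finite.of_basis (MonoidAlgebra.basis (G ⧸ D) ℚ)
  have : Module.Finite ℚ[G] (Representation.ofMulAction ℚ G (G ⧸ D)).asModule :=
    Module.Finite.of_restrictScalars_finite ℚ ℚ[G] _
  mk (Representation.ofMulAction ℚ G (G ⧸ D)).asModule

theorem character_permClass (D : Subgroup G) (g : G) :
    character G (permClass D) g = Nat.card {x : G ⧸ D // g • x = x} := by
  classical
  have : Module.Finite ℚ ℚ[G ⧸ D] := Module.Finite.of_basis (MonoidAlgebra.basis (G ⧸ D) ℚ)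
  have : Module.Finite ℚ[G] (Representation.ofMulAction ℚ G (G ⧸ D)).asModule :=
    Module.Finite.of_restrictScalars_finite ℚ ℚ[G] _
  have : Fintype (G ⧸ D) := Fintype.ofFinite _
  let ρ := Representation.ofMulAction ℚ G (G ⧸ D)
  rw [permClass, character_mk, moduleCharacter_apply, ← LinearMap.trace_conj' _ ρ.asModuleEquiv]
  have : ρ.asModuleEquiv.conj (Representation.ofModule' (k := ℚ) (G := G) ρ.asModule g) = ρ g := by
    refine LinearMap.ext fun v => ?_
    rw [LinearEquiv.conj_apply_apply, ofModule'_apply, Representation.asModuleEquiv_map_smul]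
    simp
  rw [this, LinearMap.trace_eq_matrix_trace ℚ (MonoidAlgebra.basis (G ⧸ D) ℚ), Matrix.trace]
  have hdiag : ∀ x y : G ⧸ D, (MonoidAlgebra.basis (G ⧸ D) ℚ).repr (single x 1) y =
      if x = y then 1 else 0 := fun x y => by
    rw [← MonoidAlgebra.basis_apply, Basis.repr_self, Finsupp.single_apply]
  simp [LinearMap.toMatrix_apply, ρ, hdiag, Nat.card_eq_fintype_card, Fintype.card_subtype]

/-- The character counts fixed points, and `g` fixes the coset `aD` exactly when `a⁻¹ * g * a ∈ D`.
-/
theorem character_permClass_ne_zero_iff (D : Subgroup G) (g : G) :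
    character G (permClass D) g ≠ 0 ↔ ∃ a : G, a⁻¹ * g * a ∈ D := by
  rw [character_permClass, Nat.cast_ne_zero, ← Nat.pos_iff_ne_zero, Nat.card_pos_iff]
  constructor
  · rintro ⟨⟨⟨x, hx⟩⟩, -⟩
    obtain ⟨a, rfl⟩ := QuotientGroup.mk_surjective x
    exact ⟨a, by simpa [mul_assoc] using inv_mem (QuotientGroup.eq.1 hx)⟩
  · rintro ⟨a, ha⟩
    refine ⟨⟨⟨(a : G ⧸ D), QuotientGroup.eq.2 ?_⟩⟩, inferInstance⟩
    simpa [mul_assoc] using inv_mem ha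

variable (G) in
/-- The rational span of the virtual characters. -/
def characterSpan : Submodule ℚ (G → ℚ) :=
  Submodule.span ℚ (Set.range (character G))

/-- Clearing denominators in a rational combination. -/
theorem exists_zsmul_mem_range_of_mem_characterSpan {f : G → ℚ} (hf : f ∈ characterSpan G) :
    ∃ n : ℤ, n ≠ 0 ∧ ∃ x, character G x = n • f := by
  induction hf using Submodule.span_induction with
  | mem f hf =>
    obtain ⟨x, rfl⟩ := hf
    exact ⟨1, one_ne_zero, x, (one_smul _ _).symm⟩
  | zero => exact ⟨1, one_ne_zero, 0, by simp⟩
  | add f g _ _ hf hg =>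
    obtain ⟨m, hm, x, hx⟩ := hf
    obtain ⟨n, hn, y, hy⟩ := hg
    refine ⟨m * n, mul_ne_zero hm hn, n • x + m • y, ?_⟩
    rw [map_add, map_zsmul, map_zsmul, hx, hy, smul_smul, smul_smul, smul_add, mul_comm n m]
  | smul q f _ hf =>
    obtain ⟨m, hm, x, hx⟩ := hf
    refine ⟨m * q.den, mul_ne_zero hm (by exact_mod_cast q.den_ne_zero), q.num • x, ?_⟩
    rw [map_zsmul, hx]
    ext g
    simp only [Pi.smul_apply, ← Int.cast_smul_eq_zsmul ℚ, smul_eq_mul]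
    push_cast
    rw [← Rat.mul_den_eq_num q]
    ring

open Classical in
/-- The indicator function of the elements that generate a cyclic subgroup conjugate to that
generated by `g`. -/
def cyclicIndicator (g : G) : G → ℚ := fun h =>
  if subgroupConjClass (Subgroup.zpowers h) = subgroupConjClass (Subgroup.zpowers g) then 1 else 0

theorem mem_characterSpan_of_cyclicIndicator_mem {f : G → ℚ}
    (hf : ∀ g h : G, subgroupConjClass (Subgroup.zpowers g) =
      subgroupConjClass (Subgroup.zpowers h) → f g = f h)
    (hS : ∀ g, f g ≠ 0 → cyclicIndicator g ∈ characterSpan G) : f ∈ characterSpan G := by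
  classical
  have := Fintype.ofFinite G
  -- The size of the class of `g`. Summing over all `g` repeats each indicator that many times,
  -- hence the division.
  let m : G → ℚ := fun g => ∑ h : G, cyclicIndicator g h
  have hsum : f = ∑ g : G, (f g / m g) • cyclicIndicator g := by
    ext k
    have hm : m k ≠ 0 := by
      refine (Finset.sum_pos' (fun h _ => ?_) ⟨k, Finset.mem_univ k, ?_⟩).ne'
      · unfold cyclicIndicator; split_ifs <;> norm_num
      · simp [cyclicIndicator]
    have hterm : ∀ g, (f g / m g) * cyclicIndicator g k = f k / m k * cyclicIndicator k g := by
      intro g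
      by_cases h : subgroupConjClass (Subgroup.zpowers k) = subgroupConjClass (Subgroup.zpowers g)
      · have hmg : m g = m k := by simp only [m, cyclicIndicator, h]
        simp [cyclicIndicator, h, hmg, hf k g h]
      · simp [cyclicIndicator, h, Ne.symm h]
    rw [Finset.sum_apply]
    simp only [Pi.smul_apply, smul_eq_mul, hterm]
    rw [← Finset.mul_sum]
    exact (div_mul_cancel₀ _ hm).symm
  rw [hsum]
  refine Submodule.sum_mem _ fun g _ => ?_
  by_cases h : f g = 0
  · simp [h]
  · exact Submodule.smul_mem _ _ (hS g h)

/-- Induction on the order of `g`. The character of `ℚ[G/⟨g⟩]` is nonzero at `g` and supported on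
elements conjugate into `⟨g⟩`; those outside the class of `g` have smaller order, so their
indicators are already in the span. -/
theorem cyclicIndicator_mem_characterSpan (g : G) : cyclicIndicator g ∈ characterSpan G := by
  classical
  induction hn : orderOf g using Nat.strong_induction_on generalizing g with
  | h n ih =>
    let D := Subgroup.zpowers g
    let π : G → ℚ := character G (permClass D)
    have hπ : π ∈ characterSpan G := Submodule.subset_span ⟨_, rfl⟩
    have hπg : π g ≠ 0 :=
      (character_permClass_ne_zero_iff D g).2 ⟨1, by simp [D]⟩
    have hrest : π - π g • cyclicIndicator g ∈ characterSpan G := by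
      refine mem_characterSpan_of_cyclicIndicator_mem (fun a b hab => ?_) fun h hh => ?_
      · have : π a = π b := character_eq_of_subgroupConjClass_eq _ hab
        simp [cyclicIndicator, hab, this]
      · have hcl : subgroupConjClass (Subgroup.zpowers h) ≠ subgroupConjClass (Subgroup.zpowers g) := by
          intro hcl
          have : π h = π g := character_eq_of_subgroupConjClass_eq _ hcl
          exact hh (by simp [cyclicIndicator, hcl, this])
        have hπh : π h ≠ 0 := by simpa [cyclicIndicator, hcl] using hh
        obtain ⟨a, ha⟩ := (character_permClass_ne_zero_iff D h).1 hπh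
        have hle : Subgroup.zpowers (a⁻¹ * h * a) ≤ Subgroup.zpowers g := by
          rwa [Subgroup.zpowers_le]
        have hord : orderOf (a⁻¹ * h * a) = orderOf h := by
          simpa using (orderOf_injective (MulAut.conj a⁻¹).toMonoidHom (MulAut.conj a⁻¹).injective h)
        refine ih (orderOf h) ?_ h rfl
        rw [← hn, ← hord]
        refine lt_of_le_of_ne (Nat.le_of_dvd (orderOf_pos g) ?_) fun heq => hcl ?_
        · rw [← Nat.card_zpowers, ← Nat.card_zpowers]
          exact Subgroup.card_dvd_of_le hle
        · refine subgroupConjClass_zpowers_eq_iff.2 ⟨a⁻¹, ?_⟩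
          rw [inv_inv]
          refine (Subgroup.eq_of_le_of_card_ge hle ?_).symm
          rw [Nat.card_zpowers, Nat.card_zpowers, heq]
    have h1 : π g • cyclicIndicator g ∈ characterSpan G := by
      have := Submodule.sub_mem _ hπ hrest
      rwa [sub_sub_cancel] at this
    have h2 := Submodule.smul_mem _ (π g)⁻¹ h1
    rwa [smul_smul, inv_mul_cancel₀ hπg, one_smul] at h2

/-- A function on a finite group whose value at an element depends only on the conjugacy class of
the cyclic subgroup generated by it has a nonzero multiple which is a virtual character. -/
theorem exists_character_eq_zsmul {f : G → ℚ}
    (hf : ∀ g h : G, subgroupConjClass (Subgroup.zpowers g) =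
      subgroupConjClass (Subgroup.zpowers h) → f g = f h) :
    ∃ n : ℤ, n ≠ 0 ∧ ∃ x, character G x = n • f :=
  exists_zsmul_mem_range_of_mem_characterSpan <|
    mem_characterSpan_of_cyclicIndicator_mem hf fun g _ => cyclicIndicator_mem_characterSpan g

end GrothendieckG

namespace FiniteSubgroupFamily

open GrothendieckG

variable {Γ : Type u} [Group Γ] (F : FiniteSubgroupFamily Γ)

variable {F} in
theorem zpowers_mem {K : Subgroup Γ} (hK : K ∈ F.carrier) {g : Γ} (hg : g ∈ K) :
    Subgroup.zpowers g ∈ F.carrier :=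
  F.mem_of_le K hK _ (Subgroup.zpowers_le.2 hg)

/-! ### Character values of elements of the limit -/

section CharValue

variable {F}

/-- The cyclic subgroup generated by `g`, as a member of the family. -/
def cyclicMember (g : Γ) (hg : Subgroup.zpowers g ∈ F.carrier) : F.carrier :=
  ⟨Subgroup.zpowers g, hg⟩

/-- The character value of an element of the limit at an element of `Γ` which generates a member of
the family. -/
def charValue (x : F.limitG ℚ) (g : Γ) (hg : Subgroup.zpowers g ∈ F.carrier) : ℚ :=
  character _ (x.1 (cyclicMember g hg)) ⟨g, Subgroup.mem_zpowers g⟩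

/-- Compatibility with restriction from `K` to `⟨g⟩` makes the value independent of `K`. -/
theorem character_eq_charValue (x : F.limitG ℚ) (K : F.carrier) (g : (K : Subgroup Γ)) :
    character _ (x.1 K) g = charValue x g (zpowers_mem K.2 g.2) := by
  rw [charValue, ← x.2.1 (cyclicMember (g : Γ) (zpowers_mem K.2 g.2)) K
    (Subgroup.zpowers_le.2 g.2), character_pullback]
  rfl

theorem charValue_add (x y : F.limitG ℚ) (g : Γ) (hg : Subgroup.zpowers g ∈ F.carrier) :
    charValue (x + y) g hg = charValue x g hg + charValue y g hg := by
  simp [charValue]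

theorem charValue_conj (x : F.limitG ℚ) (γ g : Γ) (hg : Subgroup.zpowers g ∈ F.carrier)
    (hg' : Subgroup.zpowers (γ * g * γ⁻¹) ∈ F.carrier) :
    charValue x (γ * g * γ⁻¹) hg' = charValue x g hg := by
  rw [charValue, charValue, ← x.2.2 (cyclicMember g hg) γ, character_pullback,
    character_eq_charValue, character_eq_charValue]
  rfl

theorem charValue_eq_of_zpowers_eq (x : F.limitG ℚ) {g h : Γ}
    (hg : Subgroup.zpowers g ∈ F.carrier) (hh : Subgroup.zpowers h ∈ F.carrier)
    (hgh : Subgroup.zpowers g = Subgroup.zpowers h) : charValue x g hg = charValue x h hh := by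
  let K : F.carrier := cyclicMember g hg
  let g' : (K : Subgroup Γ) := ⟨g, Subgroup.mem_zpowers g⟩
  let h' : (K : Subgroup Γ) := ⟨h, hgh.symm.le (Subgroup.mem_zpowers h)⟩
  have hz : Subgroup.zpowers g' = Subgroup.zpowers h' := by
    apply Subgroup.map_injective (K : Subgroup Γ).subtype_injective
    rw [MonoidHom.map_zpowers, MonoidHom.map_zpowers]
    exact hgh
  have := character_eq_of_zpowers_eq (x.1 K) hz
  rwa [character_eq_charValue, character_eq_charValue] at this

theorem charValue_eq_of_subgroupConjClass_eq (x : F.limitG ℚ) {g h : Γ}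
    (hg : Subgroup.zpowers g ∈ F.carrier) (hh : Subgroup.zpowers h ∈ F.carrier)
    (hgh : subgroupConjClass (Subgroup.zpowers g) = subgroupConjClass (Subgroup.zpowers h)) :
    charValue x g hg = charValue x h hh := by
  obtain ⟨γ, hγ⟩ := subgroupConjClass_zpowers_eq_iff.1 hgh
  rw [← charValue_conj x γ g hg (hγ ▸ hh)]
  exact charValue_eq_of_zpowers_eq x _ _ hγ.symm

theorem exists_int_charValue_eq (x : F.limitG ℚ) (g : Γ) (hg : Subgroup.zpowers g ∈ F.carrier) :
    ∃ z : ℤ, charValue x g hg = z :=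
  exists_int_character_eq _ _

theorem eq_zero_of_charValue_eq_zero {x : F.limitG ℚ} (hx : ∀ g hg, charValue x g hg = 0) :
    x = 0 := by
  ext K : 2
  apply character_injective
  ext g
  rw [character_eq_charValue, hx]
  simp

end CharValue

/-! ### The conjugacy classes of cyclic subgroups in the family -/

/-- The set of conjugacy classes of cyclic subgroups in the family. -/
def cyclicClasses : Set (Set (Subgroup Γ)) :=
  {c | ∃ H ∈ F.carrier, IsCyclic H ∧ c = subgroupConjClass H}

theorem finite_cyclicClasses (hΓ : FiniteConjugacyProperty Γ) : F.cyclicClasses.Finite :=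
  hΓ.subset fun _ ⟨H, hH, _, hc⟩ => ⟨H, F.finite_of_mem H hH, hc⟩

theorem exists_generator (c : F.cyclicClasses) : ∃ g : Γ, Subgroup.zpowers g ∈ F.carrier ∧
    subgroupConjClass (Subgroup.zpowers g) = c := by
  obtain ⟨c, H, hH, hcyc, rfl⟩ := c
  obtain ⟨g, hg⟩ := (Subgroup.isCyclic_iff_exists_zpowers_eq_top H).1 hcyc
  exact ⟨g, hg ▸ hH, by rw [hg]⟩

/-- A generator of a cyclic subgroup in the given conjugacy class. -/
def generator (c : F.cyclicClasses) : Γ := (F.exists_generator c).choose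

theorem zpowers_generator_mem (c : F.cyclicClasses) :
    Subgroup.zpowers (F.generator c) ∈ F.carrier :=
  (F.exists_generator c).choose_spec.1

theorem subgroupConjClass_zpowers_generator (c : F.cyclicClasses) :
    subgroupConjClass (Subgroup.zpowers (F.generator c)) = c :=
  (F.exists_generator c).choose_spec.2

/-- The character values of an element of the limit, one for each conjugacy class of cyclic
subgroups. -/
def charTable : F.limitG ℚ →+ (F.cyclicClasses → ℤ) where
  toFun x c := (exists_int_charValue_eq x _ (F.zpowers_generator_mem c)).choose
  map_zero' := by
    ext c
    have h := (exists_int_charValue_eq 0 _ (F.zpowers_generator_mem c)).choose_spec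
    rw [← Int.cast_inj (α := ℚ), ← h]
    simp [charValue]
  map_add' x y := by
    ext c
    have h := fun z : F.limitG ℚ =>
      (exists_int_charValue_eq z _ (F.zpowers_generator_mem c)).choose_spec
    rw [Pi.add_apply, ← Int.cast_inj (α := ℚ), Int.cast_add, ← h, ← h, ← h, charValue_add]

theorem charTable_apply (x : F.limitG ℚ) (c : F.cyclicClasses) :
    (F.charTable x c : ℚ) = charValue x (F.generator c) (F.zpowers_generator_mem c) :=
  (exists_int_charValue_eq x _ (F.zpowers_generator_mem c)).choose_spec.symm

theorem charTable_injective : Function.Injective F.charTable := by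
  rw [injective_iff_map_eq_zero]
  intro x hx
  refine eq_zero_of_charValue_eq_zero fun g hg => ?_
  let c : F.cyclicClasses := ⟨_, Subgroup.zpowers g, hg, inferInstance, rfl⟩
  have h := F.charTable_apply x c
  rw [hx, Pi.zero_apply, Int.cast_zero] at h
  rw [h]
  exact charValue_eq_of_subgroupConjClass_eq x _ _ (F.subgroupConjClass_zpowers_generator c).symm

/-! ### Elements of the limit with prescribed character values -/

open Classical in
/-- The indicator function of the elements generating a cyclic subgroup in a conjugacy class. -/
def classIndicator (c : Set (Subgroup Γ)) (g : Γ) : ℚ :=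
  if subgroupConjClass (Subgroup.zpowers g) = c then 1 else 0

theorem classIndicator_conj (c : Set (Subgroup Γ)) (γ g : Γ) :
    classIndicator c (γ * g * γ⁻¹) = classIndicator c g := by
  rw [classIndicator, classIndicator,
    (subgroupConjClass_zpowers_eq_iff (g := g) (h := γ * g * γ⁻¹)).2 ⟨γ, rfl⟩]

theorem exists_character_eq_zsmul_classIndicator (c : Set (Subgroup Γ)) (K : F.carrier) :
    ∃ n : ℤ, n ≠ 0 ∧ ∃ x, ∀ g : (K : Subgroup Γ),
      character _ x g = n • classIndicator c (g : Γ) := by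
  obtain ⟨n, hn, x, hx⟩ := exists_character_eq_zsmul (G := (K : Subgroup Γ))
    (f := fun g => classIndicator c (g : Γ)) fun g h hgh => by
      simp only [classIndicator, subgroupConjClass_zpowers_coe_eq hgh]
  exact ⟨n, hn, x, fun g => congr_fun hx g⟩

/-- A multiple that works for `K₀` works for its conjugates, by pulling back along conjugation. With
finitely many classes of finite subgroups, the product of the multiples works for all. -/
theorem exists_character_eq_zsmul_classIndicator_uniform (hΓ : FiniteConjugacyProperty Γ)
    (c : Set (Subgroup Γ)) : ∃ n : ℤ, n ≠ 0 ∧ ∀ K : F.carrier, ∃ x, ∀ g : (K : Subgroup Γ),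
      character _ x g = n • classIndicator c (g : Γ) := by
  have hclass : ∀ t : Set (Subgroup Γ), ∃ n : ℤ, n ≠ 0 ∧ ∀ K : F.carrier,
      subgroupConjClass (K : Subgroup Γ) = t → ∃ x, ∀ g : (K : Subgroup Γ),
        character _ x g = n • classIndicator c (g : Γ) := by
    intro t
    by_cases ht : ∃ K : F.carrier, subgroupConjClass (K : Subgroup Γ) = t
    · obtain ⟨K₀, rfl⟩ := ht
      obtain ⟨n, hn, x, hx⟩ := F.exists_character_eq_zsmul_classIndicator c K₀
      refine ⟨n, hn, fun K hK => ?_⟩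
      obtain ⟨γ, hγ⟩ := subgroupConjClass_eq_iff.1 hK
      obtain rfl : K₀ = F.conj γ K := Subtype.ext hγ
      refine ⟨pullback ℚ (F.conjMap γ K) x, fun g => ?_⟩
      rw [character_pullback, hx, ← classIndicator_conj c γ g]
      rfl
    · exact ⟨1, one_ne_zero, fun K hK => (ht ⟨K, hK⟩).elim⟩
  choose n hn h using hclass
  refine ⟨∏ t ∈ hΓ.toFinset, n t, Finset.prod_ne_zero_iff.2 fun t _ => hn t, fun K => ?_⟩
  obtain ⟨x, hx⟩ := h _ K rfl
  have hmem : subgroupConjClass (K : Subgroup Γ) ∈ hΓ.toFinset :=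
    hΓ.mem_toFinset.2 ⟨K, F.finite_of_mem K K.2, rfl⟩
  obtain ⟨m, hm⟩ := Finset.dvd_prod_of_mem n hmem
  refine ⟨m • x, fun g => ?_⟩
  rw [map_zsmul, Pi.smul_apply, hx, smul_smul, hm, mul_comm]

/-- With `n` independent of `K`, the chosen `x K` all have characters restricted from one
conjugation-invariant function on `Γ`. Injectivity of the character then forces the limit
conditions. -/
theorem exists_limitG_charValue_eq (hΓ : FiniteConjugacyProperty Γ) (c : Set (Subgroup Γ)) :
    ∃ n : ℤ, n ≠ 0 ∧ ∃ x : F.limitG ℚ, ∀ g hg, charValue x g hg = n • classIndicator c g := by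
  obtain ⟨n, hn, h⟩ := F.exists_character_eq_zsmul_classIndicator_uniform hΓ c
  choose x hx using h
  refine ⟨n, hn, ⟨x, fun H K hHK => ?_, fun H γ => ?_⟩, fun g hg => hx _ _⟩
  · apply character_injective
    ext g
    rw [character_pullback, hx, hx]
    rfl
  · apply character_injective
    ext g
    rw [character_pullback, hx, hx, ← classIndicator_conj c γ g]
    rfl

theorem exists_charTable_eq_single (hΓ : FiniteConjugacyProperty Γ) [DecidableEq F.cyclicClasses]
    (c : F.cyclicClasses) :
    ∃ n : ℤ, n ≠ 0 ∧ ∃ x : F.limitG ℚ, F.charTable x = Pi.single c n := by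
  obtain ⟨n, hn, x, hx⟩ := F.exists_limitG_charValue_eq hΓ c
  refine ⟨n, hn, x, ?_⟩
  ext d
  rw [← Int.cast_inj (α := ℚ), charTable_apply, hx, classIndicator,
    subgroupConjClass_zpowers_generator]
  by_cases h : d = c
  · subst h
    simp
  · simp [Subtype.coe_injective.ne h, h]

end FiniteSubgroupFamily

/-! ### Comparison of ranks -/

theorem proposition2p3 {Γ : Type u} [Group Γ] (hΓ : FiniteConjugacyProperty Γ)
    (F : FiniteSubgroupFamily Γ) :
    Module.Free ℤ (F.limitG ℚ) ∧ Module.Finite ℤ (F.limitG ℚ) ∧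
      Module.finrank ℤ (F.limitG ℚ) = F.numCyclicClasses := by
  classical
  have : Fintype F.cyclicClasses := (F.finite_cyclicClasses hΓ).fintype
  let Φ : F.limitG ℚ →ₗ[ℤ] (F.cyclicClasses → ℤ) := F.charTable.toIntLinearMap
  have hΦ : Function.Injective Φ := F.charTable_injective
  let e := LinearEquiv.ofInjective Φ hΦ
  -- The range of `Φ` is a subgroup of a free abelian group of finite rank.
  have hfree : Module.Free ℤ (F.limitG ℚ) := Module.Free.of_equiv e.symm
  have hfin : Module.Finite ℤ (F.limitG ℚ) := Module.Finite.equiv e.symm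
  refine ⟨hfree, hfin, ?_⟩
  have hcard : F.numCyclicClasses = finrank ℤ (F.cyclicClasses → ℤ) := by
    rw [finrank_fintype_fun_eq_card, ← Nat.card_eq_fintype_card]
    rfl
  rw [hcard]
  choose n hn x hx using F.exists_charTable_eq_single hΓ
  refine le_antisymm (LinearMap.finrank_le_finrank_of_injective hΦ) ?_
  -- `Φ ∘ Ψ` is diagonal with nonzero entries `n c`, so `Ψ` is injective and gives the lower bound
  -- on the rank.
  let Ψ : (F.cyclicClasses → ℤ) →ₗ[ℤ] F.limitG ℚ := Fintype.linearCombination ℤ x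
  have hΨ : ∀ v c, Φ (Ψ v) c = v c * n c := fun v c => by
    have hx' : ∀ d, Φ (x d) = Pi.single d (n d) := hx
    simp [Ψ, Fintype.linearCombination_apply, hx', Pi.single_apply]
  refine LinearMap.finrank_le_finrank_of_injective (f := Ψ) fun v w hvw => ?_
  ext c
  have := hΨ v c
  rw [hvw, hΨ] at this
  exact (mul_right_cancel₀ (hn c) this).symm

end
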